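/- Let $D\subsetneq\mathbb C^n$ be a proper open set. Let $s_D$ be the signed distance to $\partial D$, negative inside $D$: $s_D(z)=-\operatorname{dist}(z,\partial D)$ for $z\in D$ and $s_D(z)=\operatorname{dist}(z,\partial D)$ for $z\notin D$ (Euclidean distance). Let $J$ be the standard complex structure of $\mathbb C^n$, $J(v)=iv$. Suppose that for every $a\in\partial D$ there is a complex (affine) hyperplane $S_a$ through $a$ such that $$\liminf_{S_a\ni z\to a,\ z\ne a}\frac{s_D(z)+s_D(a+J(z-a))}{|z-a|^2}\ \ge\ 0,$$ where the lower limit is taken in $[-\infty,+\infty]$ (for $n=1$, where $S_a=\{a\}$, the condition is void). Then $D$ is pseudoconvex, i.e. there is a continuous plurisubharmonic function $u:D\to\mathbb R$ such that $\{z\in D: u(z)<c\}$ is relatively compact in $D$ for every $c\in\mathbb R$. -/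

import Mathlib

noncomputable section

namespace SeveralComplexVariables

/-- `ℂⁿ` with its Euclidean norm. -/
abbrev Cn (n : ℕ) : Type := EuclideanSpace ℂ (Fin n)

open Classical in
/-- The signed distance to the boundary of `D`, with the convention that it is negative in `D`
and nonnegative off `D`. -/
def boundarySignedDist {n : ℕ} (D : Set (Cn n)) (z : Cn n) : ℝ :=
  if z ∈ D then -Metric.infDist z (frontier D) else Metric.infDist z (frontier D)

/-- `S` is a complex (affine) hyperplane of `ℂⁿ` that passes through `a`. -/
def IsComplexHyperplaneThrough {n : ℕ} (S : AffineSubspace ℂ (Cn n)) (a : Cn n) : Prop :=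
  a ∈ S ∧ Module.finrank ℂ S.direction + 1 = n

/-- The standard complex structure of `ℂⁿ`: multiplication by the imaginary unit. -/
def standardJ {n : ℕ} (v : Cn n) : Cn n := Complex.I • v

/-- `u` is a continuous (real-valued) plurisubharmonic function on `D`: it is continuous on `D`
and satisfies the sub-mean-value inequality
`u a ≤ (2π)⁻¹ ∫₀^{2π} u (a + e^{iθ} X) dθ` for every closed complex disc
`{a + ζ X : |ζ| ≤ 1}` (with centre `a` and direction `X`) contained in `D`. -/
structure IsContinuousPSHOn {n : ℕ} (u : Cn n → ℝ) (D : Set (Cn n)) : Prop where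
  continuousOn : ContinuousOn u D
  le_circleAverage : ∀ a X : Cn n, (∀ ζ : ℂ, ‖ζ‖ ≤ 1 → a + ζ • X ∈ D) →
    u a ≤ Real.circleAverage (fun ζ : ℂ => u (a + ζ • X)) 0 1

/-- An open set `D` in `ℂⁿ` is pseudoconvex if it carries a continuous plurisubharmonic
exhaustion function: every sublevel set `{z ∈ D : u z < c}` is relatively compact in `D`. -/
def IsPseudoconvex {n : ℕ} (D : Set (Cn n)) : Prop :=
  IsOpen D ∧ ∃ u : Cn n → ℝ, IsContinuousPSHOn u D ∧
    ∀ c : ℝ, ∃ K : Set (Cn n), IsCompact K ∧ K ⊆ D ∧ {z ∈ D | u z < c} ⊆ K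

end SeveralComplexVariables

end

/-!
Write `d` for the distance to the boundary of `D` and `s` for the signed distance. The exhaustion
function is `max (-log d) ‖z‖`, and the point is that `-log d` is plurisubharmonic.

Suppose it is not. Then the sub-mean-value inequality fails on some disc, and
`exists_strict_superharmonic_touching` gives a point `z₀ ∈ D`, a direction `X`, an entire function
`F` with `F(0) = 0` and `δ > 0` such that `d(z₀ + τX) ≥ d(z₀) exp(-Re F(τ) + δ|τ|²)` for small `τ`.
So `D` contains the balls `B_τ` about `z₀ + τX` with these radii. Let `b = z₀ + η` be a boundary
point nearest to `z₀`. Since `b` lies in no `B_τ`, a first-order comparison shows that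
`v = X - F'(0)η` is orthogonal to `η` over `ℂ`. The ball about `z₀` forces the hyperplane `S_b` to
be the complex tangent space `b + η^⊥` (`direction_eq_orthogonal_of_liminf_nonneg`), so
`b + τv ∈ S_b`. The distance from `b + τv` to the centre of `B_τ` is `‖η‖ |1 - F'(0)τ|`, whence
`s(b + τv) ≤ ‖η‖ |1 - F'(0)τ| (Re L(τ) - δ|τ|²)` with `L(τ) = log(1 - F'(0)τ) + F(τ)`.
Here `L(τ) = gτ² + o(τ²)`, so that on adding the estimates for `τ = t` and `τ = it` the terms
`± Re g t²` cancel and `s(b + tv) + s(b + itv) ≤ -2δ‖η‖t² + o(t²)`. This contradicts the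
lower limit condition on `S_b` if `v ≠ 0`, and it contradicts `s(b) = 0` if `v = 0`
(`not_eventually_strict_touching`).
-/

namespace SeveralComplexVariables

open Filter Topology Metric
open scoped ComplexConjugate

/-! ### One complex variable -/

/-- Real continuous functions on the unit circle are uniform limits of real parts of holomorphic
polynomials, since `z⁻¹` is the conjugate of `z` there. This replaces the solution of the Dirichlet
problem. -/
theorem exists_polynomial_re_approx_on_circle {h : ℂ → ℝ}
    (hh : ContinuousOn h (sphere 0 1)) {κ : ℝ} (hκ : 0 < κ) :
    ∃ P : Polynomial ℂ, ∀ ζ ∈ sphere (0 : ℂ) 1, |h ζ - (P.eval ζ).re| < κ := by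
  have : Fact (0 < 2 * Real.pi) := ⟨Real.two_pi_pos⟩
  have hcont : Continuous fun x : AddCircle (2 * Real.pi) => (h (x.toCircle : ℂ) : ℂ) := by
    refine Complex.continuous_ofReal.comp (hh.comp_continuous ?_ fun x => by
      rw [mem_sphere_zero_iff_norm]; exact Circle.norm_coe _)
    exact continuous_subtype_val.comp AddCircle.continuous_toCircle
  have hspan : ∀ T ∈ Submodule.span ℂ (Set.range (@fourier (2 * Real.pi))),
      ∃ P Q : Polynomial ℂ, ∀ x : AddCircle (2 * Real.pi),
        T x = P.eval (x.toCircle : ℂ) + conj (Q.eval (x.toCircle : ℂ)) := by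
    intro T hT
    induction hT using Submodule.span_induction with
    | mem T hT =>
      obtain ⟨n, rfl⟩ := hT
      obtain ⟨k, rfl | rfl⟩ := n.eq_nat_or_neg
      · exact ⟨Polynomial.X ^ k, 0, fun x => by
          simp [fourier_apply, AddCircle.toCircle_nsmul]⟩
      · exact ⟨0, Polynomial.X ^ k, fun x => by
          simp only [fourier_apply, neg_smul, natCast_zsmul, AddCircle.toCircle_neg,
            AddCircle.toCircle_nsmul, Circle.coe_inv_eq_conj, Circle.coe_pow, Polynomial.eval_zero,
            Polynomial.eval_pow, Polynomial.eval_X, zero_add]⟩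
    | zero => exact ⟨0, 0, fun x => by simp⟩
    | add S T _ _ hS hT =>
      obtain ⟨P, Q, h1⟩ := hS
      obtain ⟨P', Q', h2⟩ := hT
      exact ⟨P + P', Q + Q', fun x => by simp [h1, h2]; ring⟩
    | smul c T _ hT =>
      obtain ⟨P, Q, h1⟩ := hT
      exact ⟨Polynomial.C c * P, Polynomial.C (conj c) * Q, fun x => by simp [h1]; ring⟩
  have hmem : (⟨_, hcont⟩ : C(AddCircle (2 * Real.pi), ℂ)) ∈
      (Submodule.span ℂ (Set.range (@fourier (2 * Real.pi)))).topologicalClosure := by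
    rw [span_fourier_closure_eq_top]; trivial
  obtain ⟨T, hT, hdist⟩ := Metric.mem_closure_iff.1 hmem κ hκ
  obtain ⟨P, Q, hPQ⟩ := hspan T hT
  refine ⟨P + Q, fun ζ hζ => ?_⟩
  obtain ⟨x, hx⟩ : ∃ x : AddCircle (2 * Real.pi), x = QuotientAddGroup.mk ζ.arg := ⟨_, rfl⟩
  have hxζ : (x.toCircle : ℂ) = ζ := by
    rw [hx, AddCircle.toCircle_apply_mk, div_self Real.two_pi_pos.ne', one_mul, Circle.coe_exp]
    have := Complex.norm_mul_exp_arg_mul_I ζ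
    rwa [mem_sphere_zero_iff_norm.1 hζ, Complex.ofReal_one, one_mul] at this
  have h1 := (ContinuousMap.dist_apply_le_dist x).trans_lt hdist
  rw [dist_eq_norm, hPQ] at h1
  have h2 := (Complex.abs_re_le_norm _).trans_lt h1
  simpa [hxζ] using h2

/-- If a continuous function violates the sub-mean-value inequality on the unit disc, then near some
point of the disc it is touched from above by a strictly superharmonic function of the form
`Re F(τ) - δ|τ|²` with `F` holomorphic. -/
theorem exists_strict_superharmonic_touching {h : ℂ → ℝ}
    (hh : ContinuousOn h (closedBall 0 1)) (hlt : Real.circleAverage h 0 1 < h 0) :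
    ∃ ζ₀ ∈ ball (0 : ℂ) 1, ∃ F : ℂ → ℂ, Differentiable ℂ F ∧ F 0 = 0 ∧ ∃ δ > 0,
      ∀ᶠ τ in 𝓝 (0 : ℂ), h (ζ₀ + τ) ≤ h ζ₀ + (F τ).re - δ * ‖τ‖ ^ 2 := by
  set δ := (h 0 - Real.circleAverage h 0 1) / 4 with hδdef
  have hδ : 0 < δ := by rw [hδdef]; linarith
  have hsph : ContinuousOn h (sphere 0 1) := hh.mono sphere_subset_closedBall
  obtain ⟨P, hP⟩ := exists_polynomial_re_approx_on_circle hsph hδ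
  have hPc : Continuous fun ζ => (P.eval ζ).re := Complex.continuous_re.comp P.continuous
  -- The mean value of `Re P` over the circle is its value at the centre.
  have hmean : Real.circleAverage (fun ζ => (P.eval ζ).re) 0 1 = (P.eval 0).re := by
    have h1 : CircleIntegrable (fun ζ => P.eval ζ) 0 1 :=
      P.continuous.continuousOn.circleIntegrable (by norm_num)
    have h2 := Complex.reCLM.circleAverage_comp_comm h1
    rw [(P.differentiable.diffContOnCl (s := ball 0 |1|)).circleAverage] at h2
    exact h2
  have hle : (P.eval 0).re ≤ Real.circleAverage h 0 1 + δ := by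
    have hi : CircleIntegrable h 0 1 := hsph.circleIntegrable (by norm_num)
    have h3 := Real.circleAverage_mono (c := 0) (R := 1) (f₁ := fun ζ => (P.eval ζ).re)
      (f₂ := fun ζ => h ζ + δ) (hPc.continuousOn.circleIntegrable (by norm_num))
      ((hsph.add continuousOn_const).circleIntegrable (by norm_num))
      (fun x hx => by
        have := (abs_lt.1 (hP x (by simpa using hx))).1
        linarith)
    rwa [hmean, Real.circleAverage_fun_add hi (circleIntegrable_const _ _ _),
      Real.circleAverage_const] at h3
  -- The small term `δ|ζ|²` makes the majorant strictly superharmonic and, by the choice of `δ`,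
  -- does not move the maximum to the circle.
  obtain ⟨ζ₀, hζ₀, hmax⟩ := (isCompact_closedBall (0 : ℂ) 1).exists_isMaxOn
    ⟨0, by simp⟩ (f := fun ζ => h ζ - (P.eval ζ).re + δ * ‖ζ‖ ^ 2)
    ((hh.sub hPc.continuousOn).add (by fun_prop))
  have hball : ζ₀ ∈ ball (0 : ℂ) 1 := by
    by_contra hnot
    have hs : ζ₀ ∈ sphere (0 : ℂ) 1 := by
      simp only [mem_ball, mem_closedBall, mem_sphere] at *
      linarith
    have h4 := hmax (show (0 : ℂ) ∈ closedBall 0 1 by simp)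
    have h5 := (abs_lt.1 (hP ζ₀ hs)).2
    have h6 : ‖ζ₀‖ = 1 := by simpa using hs
    simp only [Set.mem_ofPred_eq, h6, norm_zero] at h4
    linarith
  -- The last term is the linear part of `δ(|ζ₀ + τ|² - |ζ₀|²)`.
  refine ⟨ζ₀, hball, fun τ => P.eval (ζ₀ + τ) - P.eval ζ₀ - 2 * δ * (conj ζ₀ * τ), ?_, ?_, δ,
    hδ, ?_⟩
  · have := P.differentiable
    fun_prop
  · simp
  · have hnear : ∀ᶠ τ in 𝓝 (0 : ℂ), ζ₀ + τ ∈ ball (0 : ℂ) 1 := by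
      have : Tendsto (fun τ : ℂ => ζ₀ + τ) (𝓝 0) (𝓝 ζ₀) := by
        exact Continuous.tendsto' (by fun_prop) _ _ (add_zero ζ₀)
      exact this.eventually (isOpen_ball.mem_nhds hball)
    filter_upwards [hnear] with τ hτ
    have h7 := hmax (ball_subset_closedBall hτ)
    simp only [Set.mem_ofPred_eq, ← Complex.normSq_eq_norm_sq, Complex.normSq_apply,
      Complex.add_re, Complex.add_im] at h7
    simp only [← Complex.normSq_eq_norm_sq, Complex.normSq_apply, Complex.sub_re, Complex.mul_re,
      Complex.mul_im, Complex.conj_re, Complex.conj_im, Complex.ofReal_re, Complex.ofReal_im,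
      Complex.re_ofNat, Complex.im_ofNat]
    linarith

theorem deriv_eq_zero_of_re_ge {G : ℂ → ℂ} (hG : DifferentiableAt ℂ G 0) (h0 : G 0 = 0) {C : ℝ}
    (hle : ∀ᶠ τ in 𝓝 (0 : ℂ), -(C * ‖τ‖ ^ 2) ≤ (G τ).re) : deriv G 0 = 0 := by
  -- Along this direction the derivative of `Re G` is `|G'(0)|²`.
  set w := conj (deriv G 0) with hw
  have hline : HasDerivAt (fun t : ℝ => (t : ℂ) * w) w 0 := by
    simpa using (Complex.ofRealCLM.hasDerivAt (x := (0 : ℝ))).mul_const w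
  have hGw : HasDerivAt (fun t : ℝ => G (t * w)) (deriv G 0 * w) 0 := by
    have h1 : HasDerivAt G (deriv G 0) (((0 : ℝ) : ℂ) * w) := by simpa using hG.hasDerivAt
    exact h1.comp_of_eq 0 hline rfl
  have hre : HasDerivAt (fun t : ℝ => (G (t * w)).re + C * ‖w‖ ^ 2 * t ^ 2)
      ((deriv G 0 * w).re) 0 := by
    have h2 := (Complex.reCLM.hasFDerivAt (x := G ((0 : ℝ) * w))).comp_hasDerivAt 0 hGw
    have h3 := ((hasDerivAt_id (0 : ℝ)).pow 2).const_mul (C * ‖w‖ ^ 2)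
    have h4 := h2.add h3
    simp only [id, Nat.cast_ofNat, Nat.add_one_sub_one, pow_one, mul_zero, mul_one, add_zero] at h4
    exact h4
  have hmin : IsLocalMin (fun t : ℝ => (G (t * w)).re + C * ‖w‖ ^ 2 * t ^ 2) 0 := by
    have h4 : Tendsto (fun t : ℝ => (t : ℂ) * w) (𝓝 0) (𝓝 0) := by
      simpa using hline.continuousAt.tendsto
    filter_upwards [h4.eventually hle] with t ht
    rw [norm_mul, Complex.norm_real, mul_pow, Real.norm_eq_abs, sq_abs] at ht
    simp only [Complex.ofReal_zero, zero_mul, h0, Complex.zero_re]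
    nlinarith
  have h5 := hmin.hasDerivAt_eq_zero hre
  rw [hw, Complex.mul_conj, Complex.ofReal_re, Complex.normSq_eq_zero] at h5
  exact h5

theorem exists_tendsto_div_sq {L : ℂ → ℂ} (hL : AnalyticAt ℂ L 0) (h0 : L 0 = 0)
    (h1 : deriv L 0 = 0) : ∃ g : ℂ, Tendsto (fun τ => L τ / τ ^ 2) (𝓝[≠] 0) (𝓝 g) := by
  have hM : AnalyticAt ℂ (dslope L 0) 0 := by
    obtain ⟨p, hp⟩ := hL
    exact ⟨_, hp.has_fpower_series_dslope_fslope⟩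
  have hN : ContinuousAt (dslope (dslope L 0) 0) 0 :=
    continuousAt_dslope_same.2 hM.differentiableAt
  refine ⟨_, (hN.tendsto.mono_left nhdsWithin_le_nhds).congr' ?_⟩
  filter_upwards [self_mem_nhdsWithin] with τ hτ
  have hτ0 : τ ≠ 0 := hτ
  have e1 := sub_smul_dslope L 0 τ
  have e2 := sub_smul_dslope (dslope L 0) 0 τ
  rw [dslope_same, h1, sub_zero, sub_zero, smul_eq_mul] at e2
  rw [h0, sub_zero, sub_zero, smul_eq_mul, ← e2] at e1
  rw [← e1]
  field_simp

/-! ### The signed distance and the lower limit condition -/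

variable {n : ℕ} {D : Set (Cn n)}

/-- A preconnected set that meets both `s` and its complement meets the frontier of `s`. -/
theorem nonempty_inter_frontier_of_isPreconnected {α : Type*} [TopologicalSpace α]
    {s t : Set α} (ht : IsPreconnected t) (hts : (t ∩ s).Nonempty) (hts' : (t ∩ sᶜ).Nonempty) :
    (t ∩ frontier s).Nonempty := by
  by_contra hemp
  have hnot : ∀ x ∈ t, x ∉ frontier s := fun x hx hxs => hemp ⟨x, hx, hxs⟩
  obtain ⟨x, hx, hxs⟩ := hts
  obtain ⟨y, hy, hys⟩ := hts'
  obtain ⟨z, -, hz, hz'⟩ := ht (interior s) (closure s)ᶜ isOpen_interior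
    isClosed_closure.isOpen_compl
    (fun z hz => by
      by_contra h
      rw [Set.mem_union, not_or, Set.notMem_compl_iff] at h
      exact hnot z hz ⟨h.2, h.1⟩)
    ⟨x, hx, by_contra fun h => hnot x hx ⟨subset_closure hxs, h⟩⟩
    ⟨y, hy, fun h => hnot y hy ⟨h, fun h' => hys (interior_subset h')⟩⟩
  exact hz' (interior_subset_closure hz)

/-- The signed distance is `1`-Lipschitz, in the form needed here: the ball about `c ∈ D` whose
radius is the boundary distance of `c` bounds the signed distance of `D` from above. For `p ∉ D`
the segment from `p` to `c` meets the boundary. -/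
theorem boundarySignedDist_le_dist_sub (c : Cn n) (hc : c ∈ D) (p : Cn n) :
    boundarySignedDist D p ≤ dist p c - infDist c (frontier D) := by
  unfold boundarySignedDist
  split_ifs with hp
  · have := infDist_le_infDist_add_dist (s := frontier D) (x := c) (y := p)
    rw [dist_comm] at this
    linarith
  · obtain ⟨q, hq, hqf⟩ := nonempty_inter_frontier_of_isPreconnected
      (convex_segment p c).isPreconnected
      ⟨c, right_mem_segment ℝ p c, hc⟩ ⟨p, left_mem_segment ℝ p c, hp⟩
    have h1 := dist_add_dist_of_mem_segment hq
    have h2 := infDist_le_dist_of_mem (x := p) hqf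
    have h3 := infDist_le_dist_of_mem (x := c) hqf
    rw [dist_comm c q] at h3
    linarith

theorem boundarySignedDist_of_mem_frontier {b : Cn n} (hb : b ∈ frontier D) :
    boundarySignedDist D b = 0 := by
  simp [boundarySignedDist, infDist_zero_of_mem hb]

/-- The condition that the lower limit of
`(s_D(z) + s_D(b + J(z - b))) / |z - b|²`, as `z` tends to `b` in `S \ {b}`, is nonnegative. -/
def SignedDistLiminfNonneg (D : Set (Cn n)) (S : AffineSubspace ℂ (Cn n)) (b : Cn n) : Prop :=
  0 ≤ liminf
    (fun z : Cn n =>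
      (((boundarySignedDist D z + boundarySignedDist D (b + standardJ (z - b))) /
        ‖z - b‖ ^ 2 : ℝ) : EReal))
    (nhdsWithin b ((S : Set (Cn n)) \ {b}))

/-- The lower limit condition restricted to a half-line `b + t y`, `t > 0`, in `S`. -/
theorem eventually_signedDist_ge_of_liminf_nonneg {b y : Cn n} {S : AffineSubspace ℂ (Cn n)}
    (hbS : b ∈ S) (hy : y ∈ S.direction) (hy0 : y ≠ 0)
    (hlim : SignedDistLiminfNonneg D S b) {δ : ℝ} (hδ : 0 < δ) :
    ∀ᶠ t : ℝ in 𝓝[>] 0, -(δ * t ^ 2) ≤ boundarySignedDist D (b + (t : ℂ) • y) +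
      boundarySignedDist D (b + ((t : ℂ) * Complex.I) • y) := by
  have hyn : 0 < ‖y‖ ^ 2 := by positivity
  have hlt : ((-(δ / ‖y‖ ^ 2) : ℝ) : EReal) < liminf
        (fun z : Cn n =>
          (((boundarySignedDist D z + boundarySignedDist D (b + standardJ (z - b))) /
            ‖z - b‖ ^ 2 : ℝ) : EReal))
        (nhdsWithin b ((S : Set (Cn n)) \ {b})) := by
    refine lt_of_lt_of_le ?_ hlim
    have : -(δ / ‖y‖ ^ 2) < 0 := neg_neg_of_pos (by positivity)
    exact_mod_cast this
  have hev := eventually_lt_of_lt_liminf hlt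
  have htend : Tendsto (fun t : ℝ => b + (t : ℂ) • y) (𝓝[>] 0)
      (nhdsWithin b ((S : Set (Cn n)) \ {b})) := by
    refine tendsto_nhdsWithin_iff.2 ⟨?_, ?_⟩
    · refine (Continuous.tendsto' ?_ _ _ ?_).mono_left nhdsWithin_le_nhds
      · fun_prop
      · simp
    · filter_upwards [self_mem_nhdsWithin] with t ht
      refine ⟨?_, ?_⟩
      · rw [add_comm]
        exact AffineSubspace.vadd_mem_of_mem_direction (S.direction.smul_mem _ hy) hbS
      · have ht0 : t ≠ 0 := ne_of_gt ht
        simp [ht0, hy0]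
  filter_upwards [htend.eventually hev, self_mem_nhdsWithin] with t h1 ht
  have ht0 : (0 : ℝ) < t := ht
  have h2 := EReal.coe_lt_coe_iff.1 h1
  rw [add_sub_cancel_left, norm_smul, Complex.norm_real, mul_pow, Real.norm_eq_abs, sq_abs,
    lt_div_iff₀ (by positivity), standardJ, smul_smul, mul_comm Complex.I] at h2
  refine le_of_eq_of_le ?_ h2.le
  field_simp

/-- At a boundary point `z₀ + η` nearest to `z₀ ∈ D`, the complex tangent hyperplane of the ball
about `z₀` is the only hyperplane on which the lower limit can be nonnegative: in a transversal
direction, suitably rotated by a complex factor, the signed distance decreases linearly. -/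
theorem direction_eq_orthogonal_of_liminf_nonneg {z₀ η : Cn n} (hz₀ : z₀ ∈ D) (hη : η ≠ 0)
    (hdist : infDist z₀ (frontier D) = ‖η‖) {S : AffineSubspace ℂ (Cn n)}
    (hS : IsComplexHyperplaneThrough S (z₀ + η))
    (hlim : SignedDistLiminfNonneg D S (z₀ + η)) :
    S.direction = (ℂ ∙ η)ᗮ := by
  have hη' : 0 < ‖η‖ := norm_pos_iff.2 hη
  -- The boundary point is seen from the inside through the ball about `z₀`.
  have hball : ∀ w : Cn n, boundarySignedDist D (z₀ + η + w) ≤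
      (2 * (inner ℂ η w).re + ‖w‖ ^ 2) / (2 * ‖η‖) := by
    intro w
    refine (boundarySignedDist_le_dist_sub z₀ hz₀ _).trans ?_
    rw [hdist, dist_eq_norm, show z₀ + η + w - z₀ = η + w by abel, le_div_iff₀ (by positivity)]
    have h1 := norm_add_sq (𝕜 := ℂ) η w
    simp only [RCLike.re_to_complex] at h1
    nlinarith [sq_nonneg (‖η + w‖ - ‖η‖)]
  have hle : S.direction ≤ (ℂ ∙ η)ᗮ := by
    intro x hx
    rw [Submodule.mem_orthogonal_singleton_iff_inner_right]
    by_contra hne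
    set y := (-(inner ℂ η x)⁻¹) • x with hydef
    have hyη : inner ℂ η y = -1 := by
      rw [hydef, inner_smul_right]; field_simp
    have hy0 : y ≠ 0 := by
      rintro h0; rw [h0, inner_zero_right] at hyη; norm_num at hyη
    have hev := eventually_signedDist_ge_of_liminf_nonneg hS.1
      (S.direction.smul_mem _ hx : y ∈ S.direction) hy0 hlim one_pos
    have hsmall : ∀ᶠ t : ℝ in 𝓝[>] 0, t * (‖y‖ ^ 2 + ‖η‖) < 1 := by
      refine nhdsWithin_le_nhds (Tendsto.eventually_lt_const one_pos (Continuous.tendsto' ?_ _ _ ?_))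
      · fun_prop
      · simp
    obtain ⟨t, h1, h2, ht⟩ := (hev.and (hsmall.and self_mem_nhdsWithin)).exists
    have ht0 : (0 : ℝ) < t := ht
    -- `⟪η, y⟫ = -1`: the linear term is `-t` at `t y` and vanishes at `t i y`.
    have e1 := hball ((t : ℂ) • y)
    have e2 := hball (((t : ℂ) * Complex.I) • y)
    rw [inner_smul_right, hyη, norm_smul] at e1 e2
    simp only [norm_mul, Complex.norm_real, Complex.norm_I, Real.norm_eq_abs, mul_pow, sq_abs,
      mul_neg, mul_one, Complex.neg_re, Complex.ofReal_re, Complex.re_ofReal_mul, Complex.I_re,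
      mul_zero, neg_zero, zero_add] at e1 e2
    rw [le_div_iff₀ (by positivity)] at e1 e2
    nlinarith [mul_pos ht0 hη', mul_pos ht0 (sub_pos.2 h2)]
  refine Submodule.eq_of_le_of_finrank_eq hle ?_
  have h1 := Submodule.finrank_add_finrank_orthogonal (ℂ ∙ η)
  rw [finrank_span_singleton hη, finrank_euclideanSpace_fin] at h1
  have h2 := hS.2
  omega

/-- The lower limit condition at the boundary point `z₀ + η` nearest to `z₀` excludes that, along
the disc `z₀ + τ X`, the boundary distance `d` dominates `‖η‖ exp(-Re F(τ) + δ|τ|²)`, that is, that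
`-log d` is touched from above at `z₀` by a strictly superharmonic function on the disc. -/
theorem not_eventually_strict_touching {z₀ η X : Cn n} (hz₀ : z₀ ∈ D) (hη : η ≠ 0)
    (hdist : infDist z₀ (frontier D) = ‖η‖) (hb : z₀ + η ∈ frontier D)
    (hS : ∃ S : AffineSubspace ℂ (Cn n), IsComplexHyperplaneThrough S (z₀ + η) ∧
      SignedDistLiminfNonneg D S (z₀ + η))
    {F : ℂ → ℂ} (hF : Differentiable ℂ F) (hF0 : F 0 = 0) {δ : ℝ} (hδ : 0 < δ)
    (htouch : ∀ᶠ τ in 𝓝 (0 : ℂ), z₀ + τ • X ∈ D ∧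
      ‖η‖ * Real.exp (-(F τ).re + δ * ‖τ‖ ^ 2) ≤ infDist (z₀ + τ • X) (frontier D)) :
    False := by
  obtain ⟨S, hSb, hlim⟩ := hS
  have hη' : 0 < ‖η‖ := norm_pos_iff.2 hη
  have hSperp := direction_eq_orthogonal_of_liminf_nonneg hz₀ hη hdist hSb hlim
  -- `v` is the velocity at `b` of the analytic disc `z₀ + τ X + e^{-F(τ)} η`.
  set v := X - deriv F 0 • η with hv
  have hsd : ∀ᶠ τ in 𝓝 (0 : ℂ), ∀ p : Cn n, boundarySignedDist D p ≤
      ‖p - (z₀ + τ • X)‖ - ‖η‖ * Real.exp (-(F τ).re + δ * ‖τ‖ ^ 2) := by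
    filter_upwards [htouch] with τ hτ p
    have := boundarySignedDist_le_dist_sub _ hτ.1 p
    rw [dist_eq_norm] at this
    linarith [hτ.2]
  -- Testing `hsd` at the boundary point itself gives `⟪η, X⟫ = ‖η‖² F'(0)`.
  have hvperp : inner ℂ η v = 0 := by
    have hG : deriv (fun τ => (‖η‖ : ℂ) ^ 2 * F τ - τ * inner ℂ η X) 0 = 0 := by
      refine deriv_eq_zero_of_re_ge (C := ‖X‖ ^ 2 / 2) (by fun_prop) (by simp [hF0]) ?_
      filter_upwards [hsd] with τ hτ
      have h1 := hτ (z₀ + η)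
      rw [boundarySignedDist_of_mem_frontier hb,
        show z₀ + η - (z₀ + τ • X) = η - τ • X by abel] at h1
      have h2 := Real.add_one_le_exp (-(F τ).re + δ * ‖τ‖ ^ 2)
      have h3 := norm_sub_sq (𝕜 := ℂ) η (τ • X)
      rw [inner_smul_right, norm_smul, mul_pow] at h3
      simp only [RCLike.re_to_complex] at h3
      have h4 : ‖η‖ * (-(F τ).re + 1) ≤ ‖η - τ • X‖ := by
        have := mul_le_mul_of_nonneg_left h2 hη'.le
        have := mul_nonneg hη'.le (mul_nonneg hδ.le (sq_nonneg ‖τ‖))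
        linarith
      -- The inequality `2 ‖η‖ ‖η - τ X‖ ≤ ‖η‖² + ‖η - τ X‖²` removes the square root.
      have h5 := sq_nonneg (‖η - τ • X‖ - ‖η‖)
      have h6 := mul_le_mul_of_nonneg_left h4 hη'.le
      rw [Complex.sub_re, ← Complex.ofReal_pow, Complex.re_ofReal_mul]
      nlinarith
    have hd : HasDerivAt (fun τ => (‖η‖ : ℂ) ^ 2 * F τ - τ * inner ℂ η X)
        ((‖η‖ : ℂ) ^ 2 * deriv F 0 - 1 * inner ℂ η X) 0 :=
      ((hF 0).hasDerivAt.const_mul _).sub ((hasDerivAt_id _).mul_const _)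
    rw [hd.deriv, one_mul] at hG
    rw [hv, inner_sub_right, inner_smul_right, inner_self_eq_norm_sq_to_K]
    simp only [Complex.coe_algebraMap]
    linear_combination -hG
  have hvS : v ∈ S.direction := by
    rw [hSperp, Submodule.mem_orthogonal_singleton_iff_inner_right, hvperp]
  -- The second-order comparison of `‖η‖ |1 - F'(0) τ|` with the radius of the touching ball.
  set L : ℂ → ℂ := fun τ => Complex.log (1 - deriv F 0 * τ) + F τ with hL
  have hslit : 1 - deriv F 0 * (0 : ℂ) ∈ Complex.slitPlane := by simp
  have hlin : HasDerivAt (fun τ : ℂ => 1 - deriv F 0 * τ) (-deriv F 0) 0 := by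
    simpa using ((hasDerivAt_id (0 : ℂ)).const_mul (deriv F 0)).const_sub 1
  have hLan : AnalyticAt ℂ L 0 := by
    refine AnalyticAt.add (AnalyticAt.clog (by fun_prop) hslit) (hF.analyticAt 0)
  have hLd : deriv L 0 = 0 := by
    have h1 := (hlin.clog hslit).add (hF 0).hasDerivAt
    have h2 : deriv L 0 = _ := h1.deriv
    rw [h2]; simp
  obtain ⟨g, hg⟩ := exists_tendsto_div_sq hLan (by simp [hL, hF0]) hLd
  have hest : ∀ᶠ τ in 𝓝 (0 : ℂ), boundarySignedDist D (z₀ + η + τ • v) ≤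
      ‖η‖ * ‖1 - deriv F 0 * τ‖ * ((L τ).re - δ * ‖τ‖ ^ 2) := by
    have hne : ∀ᶠ τ in 𝓝 (0 : ℂ), 1 - deriv F 0 * τ ≠ 0 := by
      refine hlin.continuousAt.eventually_ne ?_
      simp
    filter_upwards [hsd, hne] with τ h1 h2
    have hx : 0 < ‖1 - deriv F 0 * τ‖ := norm_pos_iff.2 h2
    refine (h1 _).trans ?_
    rw [show z₀ + η + τ • v - (z₀ + τ • X) = (1 - deriv F 0 * τ) • η by
      rw [hv]; module, norm_smul]
    have h3 := Real.add_one_le_exp (-((L τ).re - δ * ‖τ‖ ^ 2))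
    have h4 : Real.exp (-(F τ).re + δ * ‖τ‖ ^ 2) =
        ‖1 - deriv F 0 * τ‖ * Real.exp (-((L τ).re - δ * ‖τ‖ ^ 2)) := by
      nth_rewrite 1 [← Real.exp_log hx]
      rw [← Real.exp_add, hL, Complex.add_re, Complex.log_re]
      congr 1; ring
    -- `x - x exp(-s) ≤ x s` for `x ≥ 0`.
    rw [h4]
    have := mul_le_mul_of_nonneg_left h3 (mul_pos hη' hx).le
    linarith
  -- Along `τ = t` and `τ = t i` the quadratic parts of `Re L` cancel.
  have hquot : ∀ c : ℂ, ‖c‖ = 1 → Tendsto (fun t : ℝ => ‖η‖ * ‖1 - deriv F 0 * (t * c)‖ *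
      ((L (t * c) / (t * c) ^ 2 * c ^ 2).re - δ)) (𝓝[>] 0) (𝓝 (‖η‖ * ((g * c ^ 2).re - δ))) := by
    intro c hc
    have hc0 : c ≠ 0 := norm_ne_zero_iff.1 (by rw [hc]; norm_num)
    have ht : Tendsto (fun t : ℝ => (t : ℂ) * c) (𝓝[>] 0) (𝓝[≠] 0) := by
      refine tendsto_nhdsWithin_iff.2 ⟨?_, ?_⟩
      · refine (Continuous.tendsto' ?_ _ _ ?_).mono_left nhdsWithin_le_nhds
        · fun_prop
        · simp
      · filter_upwards [self_mem_nhdsWithin] with t ht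
        have ht0 : t ≠ 0 := ne_of_gt ht
        simp [ht0, hc0]
    have h1 := (Complex.continuous_re.tendsto _).comp ((hg.comp ht).mul_const (c ^ 2))
    have h2 : Tendsto (fun t : ℝ => ‖1 - deriv F 0 * (t * c)‖) (𝓝[>] 0) (𝓝 1) := by
      refine (Continuous.tendsto' ?_ _ _ ?_).mono_left nhdsWithin_le_nhds
      · fun_prop
      · simp
    have h3 := (h2.const_mul ‖η‖).mul (h1.sub_const δ)
    rw [mul_one] at h3
    exact h3
  have hestc : ∀ c : ℂ, ‖c‖ = 1 → ∀ᶠ t : ℝ in 𝓝[>] 0,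
      boundarySignedDist D (z₀ + η + ((t : ℂ) * c) • v) ≤
      t ^ 2 * (‖η‖ * ‖1 - deriv F 0 * (t * c)‖ * ((L (t * c) / (t * c) ^ 2 * c ^ 2).re - δ)) := by
    intro c hc
    have hc0 : c ≠ 0 := norm_ne_zero_iff.1 (by rw [hc]; norm_num)
    have ht : Tendsto (fun t : ℝ => (t : ℂ) * c) (𝓝[>] 0) (𝓝 0) := by
      refine (Continuous.tendsto' ?_ _ _ ?_).mono_left nhdsWithin_le_nhds
      · fun_prop
      · simp
    filter_upwards [ht.eventually hest, self_mem_nhdsWithin] with t h1 ht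
    have ht0 : (t : ℂ) ≠ 0 := by exact_mod_cast ne_of_gt ht
    refine h1.trans_eq ?_
    have e1 : L (t * c) = ((t ^ 2 : ℝ) : ℂ) * (L (t * c) / (t * c) ^ 2 * c ^ 2) := by
      push_cast; field_simp
    have e2 : (L (t * c)).re = t ^ 2 * (L (t * c) / (t * c) ^ 2 * c ^ 2).re := by
      rw [← Complex.re_ofReal_mul, ← e1]
    rw [e2, norm_mul, hc, Complex.norm_real, Real.norm_eq_abs, mul_one, sq_abs]
    ring
  have hsum := (hquot 1 (by simp)).add (hquot Complex.I (by simp))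
  have hlt := hsum.eventually_lt_const (show _ < -(‖η‖ * δ) by
    simp only [one_pow, mul_one, Complex.I_sq, mul_neg, Complex.neg_re]
    nlinarith [mul_pos hη' hδ])
  have hneg : ∀ᶠ t : ℝ in 𝓝[>] 0, boundarySignedDist D (z₀ + η + (t : ℂ) • v) +
      boundarySignedDist D (z₀ + η + ((t : ℂ) * Complex.I) • v) < -(‖η‖ * δ * t ^ 2) := by
    filter_upwards [hlt, hestc 1 (by simp), hestc Complex.I (by simp), self_mem_nhdsWithin]
      with t h1 h2 h3 ht
    have ht2 : 0 < t ^ 2 := pow_pos ht 2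
    have := mul_lt_mul_of_pos_left h1 ht2
    rw [mul_one (t : ℂ)] at *
    linarith
  by_cases hv0 : v = 0
  · -- Then both points are the boundary point itself, where the signed distance vanishes.
    obtain ⟨t, h1, ht⟩ := (hneg.and self_mem_nhdsWithin).exists
    have ht2 : 0 < t ^ 2 := pow_pos ht 2
    rw [hv0, smul_zero, smul_zero, add_zero, boundarySignedDist_of_mem_frontier hb] at h1
    nlinarith [mul_pos (mul_pos hη' hδ) ht2]
  · obtain ⟨t, h1, h2⟩ := (hneg.and (eventually_signedDist_ge_of_liminf_nonneg hSb.1 hvS hv0 hlim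
      (mul_pos hη' hδ))).exists
    linarith

/-! ### Plurisubharmonicity and exhaustion -/

theorem infDist_frontier_pos (hD : IsOpen D) (hne : (frontier D).Nonempty) {z : Cn n}
    (hz : z ∈ D) : 0 < infDist z (frontier D) := by
  refine (isClosed_frontier.notMem_iff_infDist_pos hne).1 fun h => ?_
  rw [hD.frontier_eq] at h
  exact h.2 hz

/-- Under the lower limit condition, minus the logarithm of the boundary distance is
plurisubharmonic. -/
theorem isContinuousPSHOn_neg_log_infDist_frontier (hD : IsOpen D)
    (hfr : (frontier D).Nonempty)
    (hS : ∀ a ∈ frontier D, ∃ S : AffineSubspace ℂ (Cn n), IsComplexHyperplaneThrough S a ∧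
      SignedDistLiminfNonneg D S a) :
    IsContinuousPSHOn (fun z => -Real.log (infDist z (frontier D))) D := by
  have hcont : ContinuousOn (fun z => -Real.log (infDist z (frontier D))) D :=
    ((continuous_infDist_pt _).continuousOn.log
      fun z hz => (infDist_frontier_pos hD hfr hz).ne').neg
  refine ⟨hcont, fun a X hdisc => ?_⟩
  by_contra! hlt
  have hh : ContinuousOn (fun ζ : ℂ => -Real.log (infDist (a + ζ • X) (frontier D)))
      (closedBall 0 1) :=
    hcont.comp (by fun_prop) fun ζ hζ => hdisc ζ (by simpa using hζ)
  obtain ⟨ζ₀, hζ₀, F, hF, hF0, δ, hδ, htouch⟩ :=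
    exists_strict_superharmonic_touching hh (by simpa using hlt)
  have hz₀ : a + ζ₀ • X ∈ D := hdisc ζ₀ (mem_ball_zero_iff.1 hζ₀).le
  obtain ⟨b, hb, hbd⟩ := isClosed_frontier.exists_infDist_eq_dist hfr (a + ζ₀ • X)
  have hpos := infDist_frontier_pos hD hfr hz₀
  have hbη : a + ζ₀ • X + (b - (a + ζ₀ • X)) = b := by abel
  have hdist : infDist (a + ζ₀ • X) (frontier D) = ‖b - (a + ζ₀ • X)‖ := by
    rw [hbd, dist_comm, dist_eq_norm]
  have hη : b - (a + ζ₀ • X) ≠ 0 := norm_pos_iff.1 (hdist ▸ hpos)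
  refine not_eventually_strict_touching (X := X) hz₀ hη hdist (by rwa [hbη])
    (by rw [hbη]; exact hS b hb) hF hF0 hδ ?_
  have hmem : ∀ᶠ τ in 𝓝 (0 : ℂ), a + ζ₀ • X + τ • X ∈ D := by
    refine (Continuous.tendsto' ?_ (0 : ℂ) _ ?_).eventually (hD.mem_nhds hz₀)
    · fun_prop
    · simp
  filter_upwards [htouch, hmem] with τ h1 h2
  refine ⟨h2, ?_⟩
  have hpos' := infDist_frontier_pos hD hfr h2
  rw [add_smul, ← add_assoc] at h1
  rw [← hdist]
  nth_rewrite 1 [← Real.exp_log hpos]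
  rw [← Real.exp_add, ← Real.le_log_iff_exp_le hpos']
  linarith

/-- The norm is plurisubharmonic. -/
theorem norm_le_circleAverage_norm (a X : Cn n) :
    ‖a‖ ≤ Real.circleAverage (fun ζ : ℂ => ‖a + ζ • X‖) 0 1 := by
  have hd : Differentiable ℂ fun ζ : ℂ => a + ζ • X := by fun_prop
  have h1 := (hd.diffContOnCl (s := ball 0 |1|)).circleAverage
  simp only [zero_smul, add_zero] at h1
  conv_lhs => rw [← h1]
  rw [Real.circleAverage, Real.circleAverage, norm_smul, smul_eq_mul,
    Real.norm_of_nonneg (by positivity)]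
  gcongr
  exact intervalIntegral.norm_integral_le_integral_norm (by positivity)

theorem IsContinuousPSHOn.max {u w : Cn n → ℝ} (hu : IsContinuousPSHOn u D)
    (hw : IsContinuousPSHOn w D) : IsContinuousPSHOn (fun z => max (u z) (w z)) D := by
  have hmax := hu.continuousOn.sup hw.continuousOn
  refine ⟨hmax, fun a X hdisc => ?_⟩
  have hint : ∀ f : Cn n → ℝ, ContinuousOn f D →
      CircleIntegrable (fun ζ : ℂ => f (a + ζ • X)) 0 1 :=
    fun f hf => (hf.comp (by fun_prop) fun ζ hζ =>
      hdisc ζ (mem_sphere_zero_iff_norm.1 hζ).le).circleIntegrable zero_le_one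
  exact max_le
    ((hu.le_circleAverage a X hdisc).trans (Real.circleAverage_mono (hint _ hu.continuousOn)
      (hint _ hmax) fun _ _ => le_max_left _ _))
    ((hw.le_circleAverage a X hdisc).trans (Real.circleAverage_mono (hint _ hw.continuousOn)
      (hint _ hmax) fun _ _ => le_max_right _ _))

end SeveralComplexVariables

open SeveralComplexVariables in
theorem mainTheorem8 (n : ℕ) (D : Set (Cn n)) (hD : IsOpen D) (hproper : D ≠ Set.univ)
    (hS : ∀ a ∈ frontier D, ∃ S : AffineSubspace ℂ (Cn n), IsComplexHyperplaneThrough S a ∧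
      0 ≤ Filter.liminf
        (fun z : Cn n =>
          (((boundarySignedDist D z + boundarySignedDist D (a + standardJ (z - a))) /
            ‖z - a‖ ^ 2 : ℝ) : EReal))
        (nhdsWithin a ((S : Set (Cn n)) \ {a}))) :
    IsPseudoconvex D := by
  refine ⟨hD, ?_⟩
  -- If `D` is empty it has no boundary, and `infDist` to the empty set is the junk value `0`.
  rcases D.eq_empty_or_nonempty with rfl | hne
  · refine ⟨fun _ => 0, ⟨continuousOn_const, fun a X h => (h 0 (by simp)).elim⟩,
      fun c => ⟨∅, isCompact_empty, subset_rfl, fun z hz => hz.1⟩⟩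
  have hfr : (frontier D).Nonempty := nonempty_frontier_iff.2 ⟨hne, hproper⟩
  refine ⟨_, (isContinuousPSHOn_neg_log_infDist_frontier hD hfr hS).max
    ⟨continuous_norm.continuousOn, fun a X _ => norm_le_circleAverage_norm a X⟩, fun c => ?_⟩
  refine ⟨closure D ∩ {z | Real.exp (-c) ≤ Metric.infDist z (frontier D)} ∩
    Metric.closedBall 0 c, ?_, ?_, ?_⟩
  · refine (isCompact_closedBall _ _).inter_left (isClosed_closure.inter ?_)
    exact isClosed_le continuous_const (Metric.continuous_infDist_pt _)
  · rintro z ⟨⟨hz, hzd⟩, -⟩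
    by_contra hzD
    have hzf : z ∈ frontier D := by rw [hD.frontier_eq]; exact ⟨hz, hzD⟩
    have h1 : Real.exp (-c) ≤ Metric.infDist z (frontier D) := hzd
    rw [Metric.infDist_zero_of_mem hzf] at h1
    exact absurd h1 (Real.exp_pos _).not_ge
  · rintro z ⟨hz, hzc⟩
    obtain ⟨h1, h2⟩ := max_lt_iff.1 hzc
    refine ⟨⟨subset_closure hz, ?_⟩, mem_closedBall_zero_iff.2 h2.le⟩
    exact ((Real.lt_log_iff_exp_lt (infDist_frontier_pos hD hfr hz)).1 (by linarith)).le
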